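/- All rings are commutative with unity. Let $R$ be a commutative ring. An ideal $J$ of $R$ is a GV-ideal if it is finitely generated and the natural map $R\to\operatorname{Hom}_R(J,R)$, $r\mapsto(x\mapsto rx)$, is an isomorphism. An $R$-module $N$ is GV-torsion-free if no nonzero $x\in N$ satisfies $Jx=0$ for a GV-ideal $J$; such an $N$ is a $w$-module if moreover $\operatorname{Ext}^1_R(R/J,N)=0$ for every GV-ideal $J$. A maximal $w$-ideal is an ideal that is maximal among the proper ideals of $R$ that are $w$-modules (such an ideal is always prime). A sequence $0\to A\to B\to C\to 0$ of $R$-modules is $w$-exact if its localization at every maximal $w$-ideal is exact, and it is $w$-pure exact if it is $w$-exact and remains $w$-exact after tensoring with any $R$-module. A submodule $A$ of $B$ is $w$-pure if $0\to A\to B\to B/A\to 0$ is $w$-pure exact. An $R$-module $A$ is absolutely $w$-pure if it is a $w$-pure submodule of every $R$-module that contains it as a submodule. An $R$-module $M$ is $w$-FP-projective if $\operatorname{Ext}^1_R(M,A)=0$ for every absolutely $w$-pure $R$-module $A$. If $R$ is a domain with fraction field $K$, the $w$-envelope of a fractional ideal $I$ is $I_w=\{x\in K : Jx\subseteq I \text{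 for some GV-ideal } J\}$, and $I$ is $w$-invertible if $(II^{-1})_w=R$, where $I^{-1}=\{x\in K : xI\subseteq R\}$. A domain $R$ is a Prüfer $v$-multiplication domain if every nonzero finitely generated ideal of $R$ is $w$-invertible. **Proposition.** Let $R$ be a Prüfer $v$-multiplication domain. Then $\operatorname{pd}_R(M)\leq 1$ for every $w$-FP-projective $R$-module $M$. -/

import Mathlib

open scoped TensorProduct nonZeroDivisors

universe u

section WOperation

variable {R : Type u} [CommRing R]

/-- A Glaz–Vasconcelos ideal: `J` is finitely generated and the natural homomorphism
`R → Hom_R(J, R)`, `r ↦ (x ↦ r * x)`, is an isomorphism. -/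
def IsGVIdeal (J : Ideal R) : Prop :=
  J.FG ∧ Function.Bijective (LinearMap.toSpanSingleton R (J →ₗ[R] R) J.subtype)

variable (R) in
/-- `M` is GV-torsion-free: the only element killed by some GV-ideal is `0`. -/
def IsGVTorsionFree (M : Type u) [AddCommGroup M] [Module R M] : Prop :=
  ∀ x : M, (∃ J : Ideal R, IsGVIdeal J ∧ ∀ a ∈ J, a • x = 0) → x = 0

variable (R) in
/-- `M` is a `w`-module: it is GV-torsion-free and `Ext¹_R(R/J, M) = 0` for every GV-ideal `J`. -/
def IsWModule (M : Type u) [AddCommGroup M] [Module R M] : Prop :=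
  IsGVTorsionFree R M ∧
    ∀ J : Ideal R, IsGVIdeal J →
      Subsingleton (CategoryTheory.Abelian.Ext (ModuleCat.of R (R ⧸ J)) (ModuleCat.of R M) 1)

/-- A maximal `w`-ideal: an ideal that is maximal among the proper ideals which are `w`-modules. -/
def IsMaximalWIdeal (p : Ideal R) : Prop :=
  Maximal (fun I : Ideal R => I ≠ ⊤ ∧ IsWModule R I) p

/-- The sequence `0 → A → B → C → 0` given by `f` and `g` is `w`-exact: its localization at every
maximal `w`-ideal `p` of `R` is exact. (Every maximal `w`-ideal is prime, so asking for the
instance `p.IsPrime`, which the localization needs, leaves out no maximal `w`-ideal.) -/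
def IsWExact {A B C : Type u} [AddCommGroup A] [Module R A] [AddCommGroup B] [Module R B]
    [AddCommGroup C] [Module R C] (f : A →ₗ[R] B) (g : B →ₗ[R] C) : Prop :=
  ∀ (p : Ideal R) [p.IsPrime], IsMaximalWIdeal p →
    Function.Injective (LocalizedModule.map p.primeCompl f) ∧
    Function.Exact (LocalizedModule.map p.primeCompl f) (LocalizedModule.map p.primeCompl g) ∧
    Function.Surjective (LocalizedModule.map p.primeCompl g)

/-- The sequence `0 → A → B → C → 0` is `w`-pure exact: it is `w`-exact, and it stays `w`-exact
after tensoring with any `R`-module. -/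
def IsWPureExact {A B C : Type u} [AddCommGroup A] [Module R A] [AddCommGroup B] [Module R B]
    [AddCommGroup C] [Module R C] (f : A →ₗ[R] B) (g : B →ₗ[R] C) : Prop :=
  IsWExact f g ∧
    ∀ (M : Type u) [AddCommGroup M] [Module R M], IsWExact (f.rTensor M) (g.rTensor M)

/-- `A` is a `w`-pure submodule of `B`: the sequence `0 → A → B → B/A → 0` is `w`-pure exact. -/
def IsWPureSubmodule {B : Type u} [AddCommGroup B] [Module R B] (A : Submodule R B) : Prop :=
  IsWPureExact A.subtype A.mkQ

variable (R) in
/-- `A` is absolutely `w`-pure: it is a `w`-pure submodule of every `R`-module containing it. -/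
def IsAbsolutelyWPure (A : Type u) [AddCommGroup A] [Module R A] : Prop :=
  ∀ (B : Type u) [AddCommGroup B] [Module R B] (f : A →ₗ[R] B), Function.Injective f →
    IsWPureSubmodule (LinearMap.range f)

variable (R) in
/-- `M` is `w`-FP-projective: `Ext¹_R(M, A) = 0` for every absolutely `w`-pure module `A`. -/
def IsWFPProjective (M : Type u) [AddCommGroup M] [Module R M] : Prop :=
  ∀ (A : Type u) [AddCommGroup A] [Module R A], IsAbsolutelyWPure R A →
    Subsingleton (CategoryTheory.Abelian.Ext (ModuleCat.of R M) (ModuleCat.of R A) 1)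

end WOperation

section PvMD

variable {R : Type u} [CommRing R] [IsDomain R]

/-- The `w`-envelope `I_w = {x ∈ K | J x ⊆ I for some GV-ideal J}` of a fractional ideal `I` of the
domain `R`; the fraction field `K` is the injective hull of `I` when `I ≠ 0`. -/
def wEnvelope (I : FractionalIdeal R⁰ (FractionRing R)) : Set (FractionRing R) :=
  {x | ∃ J : Ideal R, IsGVIdeal J ∧ ∀ a ∈ J, a • x ∈ I}

/-- A fractional ideal `I` is `w`-invertible if `(I I⁻¹)_w = R`. -/
def IsWInvertible (I : FractionalIdeal R⁰ (FractionRing R)) : Prop :=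
  wEnvelope (I * I⁻¹) = Set.range (algebraMap R (FractionRing R))

variable (R) in
/-- The domain `R` is a Prüfer `v`-multiplication domain: every nonzero finitely generated ideal
is `w`-invertible. -/
def IsPvMD : Prop :=
  ∀ I : Ideal R, I ≠ ⊥ → I.FG → IsWInvertible (I : FractionalIdeal R⁰ (FractionRing R))

end PvMD

/-! Embed any `Y` in an injective module `E`. Then `Ext²(M, Y)` is a quotient of `Ext¹(M, E/Y)`, and
`E/Y` is divisible, so it suffices that divisible modules `D` are absolutely `w`-pure. This is
checked at a maximal `w`-ideal `p`. No GV-ideal lies in `p`, so `w`-invertibility of two-generated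
ideals makes `R_p` a valuation ring. There `M_p` modulo its torsion is flat. Since torsion tensored
with `D` vanishes, `M_p ⊗ D` only sees the flat quotient, so tensoring `D ⊆ B` with `M_p` stays
injective. -/

open CategoryTheory in
/-- If `Ext¹(R/J, N) = 0`, then every linear map `J → N` extends to `R`. -/
theorem exists_smul_eq_of_subsingleton_ext {R : Type u} [CommRing R] {N : Type u} [AddCommGroup N]
    [Module R N] (J : Ideal R)
    (h : Subsingleton (Abelian.Ext (ModuleCat.of R (R ⧸ J)) (ModuleCat.of R N) 1))
    (φ : J →ₗ[R] N) : ∃ x : N, ∀ a : J, φ a = (a : R) • x := by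
  have hS : (ModuleCat.shortComplexOfCompEqZero J.subtype J.mkQ
      (LinearMap.exact_subtype_mkQ J).linearMap_comp_eq_zero).ShortExact :=
    ModuleCat.shortComplex_shortExact _ (LinearMap.exact_subtype_mkQ J) J.injective_subtype
      J.mkQ_surjective
  obtain ⟨e, he⟩ := Abelian.Ext.contravariant_sequence_exact₁ hS _
    (Abelian.Ext.mk₀ (ModuleCat.ofHom φ)) (n₁ := 1) rfl (h.elim _ _)
  obtain ⟨ψ, rfl⟩ := (Abelian.Ext.mk₀_bijective _ _).2 e
  rw [Abelian.Ext.mk₀_comp_mk₀] at he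
  have hψ := (Abelian.Ext.mk₀_bijective _ _).1 he
  refine ⟨ψ.hom (1 : R), fun a => ?_⟩
  have h1 : ψ.hom (a : R) = φ a := congr($(hψ).hom a)
  have h2 : ψ.hom ((a : R) • (1 : R)) = (a : R) • ψ.hom (1 : R) := map_smul _ _ _
  rw [← h1, ← h2, smul_eq_mul, mul_one]

/-- A GV-ideal is not contained in a maximal `w`-ideal. -/
theorem IsGVIdeal.not_le_of_isMaximalWIdeal {R : Type u} [CommRing R] {J p : Ideal R}
    (hJ : IsGVIdeal J) (hp : IsMaximalWIdeal p) : ¬ J ≤ p := by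
  intro hle
  -- As `p` is a `w`-module, the inclusion `J → p` is multiplication by some `x ∈ p`; injectivity of
  -- `R → Hom(J, R)` forces `x = 1`.
  obtain ⟨x, hx⟩ := exists_smul_eq_of_subsingleton_ext J (hp.prop.2.2 J hJ)
    (Submodule.inclusion hle)
  have h1 : (1 : R) = x := by
    apply hJ.2.1
    ext a
    simpa [mul_comm] using congr(($(hx a) : R))
  exact hp.prop.1 ((Ideal.eq_top_iff_one p).2 (h1 ▸ x.2))

/-- Write `z = ax + by` with `x, y` in the inverse ideal and take `u = ax`, `v = bx`, `s = ay`, `t =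
by`. Where `u` is a unit, `a` divides `b`; where `t` is a unit, `b` divides `a`. -/
theorem FractionalIdeal.exists_add_eq_of_mem_span_pair_mul_inv {R : Type u} [CommRing R]
    [IsDomain R] {a b : R} (hab : Ideal.span {a, b} ≠ ⊥) {z : FractionRing R}
    (hz : z ∈ (Ideal.span {a, b} : FractionalIdeal R⁰ (FractionRing R)) *
      (Ideal.span {a, b} : FractionalIdeal R⁰ (FractionRing R))⁻¹) :
    ∃ u v s t : R, algebraMap R (FractionRing R) (u + t) = z ∧ b * u = a * v ∧ a * t = b * s := by
  have hne : (Ideal.span {a, b} : FractionalIdeal R⁰ (FractionRing R)) ≠ 0 :=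
    FractionalIdeal.coeIdeal_ne_zero.2 hab
  have key : ∃ x y : FractionRing R,
      x ∈ (Ideal.span {a, b} : FractionalIdeal R⁰ (FractionRing R))⁻¹ ∧
      y ∈ (Ideal.span {a, b} : FractionalIdeal R⁰ (FractionRing R))⁻¹ ∧
      algebraMap R _ a * x + algebraMap R _ b * y = z := by
    refine FractionalIdeal.mul_induction_on hz ?_ ?_
    · intro i hi j hj
      obtain ⟨i, hi', rfl⟩ := (FractionalIdeal.mem_coeIdeal _).1 hi
      obtain ⟨c, d, rfl⟩ := Ideal.mem_span_pair.1 hi'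
      refine ⟨c • j, d • j, Submodule.smul_mem _ c hj, Submodule.smul_mem _ d hj, ?_⟩
      simp only [Algebra.smul_def, map_add, map_mul]
      ring
    · rintro _ _ ⟨x, y, hx, hy, rfl⟩ ⟨x', y', hx', hy', rfl⟩
      exact ⟨x + x', y + y', Submodule.add_mem _ hx hx', Submodule.add_mem _ hy hy', by ring⟩
  obtain ⟨x, y, hx, hy, rfl⟩ := key
  have hmul : ∀ w ∈ (Ideal.span {a, b} : FractionalIdeal R⁰ (FractionRing R))⁻¹,
      ∀ c ∈ Ideal.span {a, b}, ∃ r : R, algebraMap R (FractionRing R) r =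
        w * algebraMap R _ c := fun w hw c hc =>
    (FractionalIdeal.mem_one_iff _).1 ((FractionalIdeal.mem_inv_iff hne).1 hw _
      (FractionalIdeal.mem_coeIdeal_of_mem _ hc))
  have ha : a ∈ Ideal.span {a, b} := Ideal.subset_span (by simp)
  have hb : b ∈ Ideal.span {a, b} := Ideal.subset_span (by simp)
  obtain ⟨u, hu⟩ := hmul x hx a ha
  obtain ⟨v, hv⟩ := hmul x hx b hb
  obtain ⟨s, hs⟩ := hmul y hy a ha
  obtain ⟨t, ht⟩ := hmul y hy b hb
  refine ⟨u, v, s, t, ?_, ?_, ?_⟩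
  · rw [map_add, hu, ht]; ring
  · apply IsFractionRing.injective R (FractionRing R)
    rw [map_mul, map_mul, hu, hv]; ring
  · apply IsFractionRing.injective R (FractionRing R)
    rw [map_mul, map_mul, hs, ht]; ring

/-- The localization of a PvMD at a maximal `w`-ideal is a valuation ring. -/
theorem IsPvMD.valuationRing_localization {R : Type u} [CommRing R] [IsDomain R] (hR : IsPvMD R)
    (p : Ideal R) [p.IsPrime] (hp : IsMaximalWIdeal p) :
    ValuationRing (Localization p.primeCompl) := by
  have hdvd : ∀ {a b u v : R}, u ∉ p → b * u = a * v →
      algebraMap R (Localization p.primeCompl) a ∣ algebraMap R _ b := by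
    intro a b u v hu h
    have hunit := IsLocalization.map_units (Localization p.primeCompl) (⟨u, hu⟩ : p.primeCompl)
    rw [← hunit.dvd_mul_right, ← map_mul, h, map_mul]
    exact dvd_mul_right _ _
  have htotal : ∀ a b : R, algebraMap R (Localization p.primeCompl) a ∣ algebraMap R _ b ∨
      algebraMap R (Localization p.primeCompl) b ∣ algebraMap R _ a := by
    intro a b
    by_cases hab : Ideal.span {a, b} = ⊥
    · have ha : a = 0 := by
        have : a ∈ Ideal.span {a, b} := Ideal.subset_span (by simp)
        simpa [hab] using this
      right
      simp [ha]
    · have h1 := hR _ hab (Submodule.fg_span (Set.toFinite _))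
      have h2 : (1 : FractionRing R) ∈ Set.range (algebraMap R (FractionRing R)) := ⟨1, map_one _⟩
      rw [← h1] at h2
      obtain ⟨J, hJ, hJ'⟩ := h2
      obtain ⟨c, hc, hcp⟩ := SetLike.not_le_iff_exists.1 (hJ.not_le_of_isMaximalWIdeal hp)
      obtain ⟨u, v, s, t, hz, hu, ht⟩ :=
        FractionalIdeal.exists_add_eq_of_mem_span_pair_mul_inv hab (hJ' c hc)
      rw [Algebra.smul_def, mul_one] at hz
      have hz' : u + t = c := IsFractionRing.injective R (FractionRing R) hz
      -- Since `u + t = c ∉ p`, one of `u`, `t` becomes a unit at `p`.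
      by_cases hup : u ∈ p
      · exact Or.inr (hdvd (fun htp => hcp (hz' ▸ p.add_mem hup htp)) ht)
      · exact Or.inl (hdvd hup hu)
  refine ValuationRing.iff_dvd_total.2 ⟨fun x y => ?_⟩
  obtain ⟨a, s, rfl⟩ := IsLocalization.exists_mk'_eq p.primeCompl x
  obtain ⟨b, t, rfl⟩ := IsLocalization.exists_mk'_eq p.primeCompl y
  have hs : ∀ (c : R) (s : p.primeCompl), Associated
      (IsLocalization.mk' (Localization p.primeCompl) c s)
      (algebraMap R _ c) := fun c s =>
    ⟨(IsLocalization.map_units (Localization p.primeCompl) s).unit, by simp⟩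
  rw [(hs a s).dvd_iff_dvd_left, (hs b t).dvd_iff_dvd_right, (hs b t).dvd_iff_dvd_left,
    (hs a s).dvd_iff_dvd_right]
  exact htotal a b

/-! ### Purity of divisible modules -/

/-- Tensoring an inclusion of a divisible module with an extension of a flat module by a torsion
module preserves injectivity. -/
theorem LinearMap.lTensor_injective_of_divisible {R : Type*} [CommRing R]
    {N F D B : Type*} [AddCommGroup N] [Module R N] [AddCommGroup F] [Module R F]
    [AddCommGroup D] [Module R D] [AddCommGroup B] [Module R B] [Module.Flat R F]
    (q : N →ₗ[R] F) (hq : Function.Surjective q)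
    (htors : ∀ n, q n = 0 → ∃ r : R, r ≠ 0 ∧ r • n = 0)
    (hD : ∀ r : R, r ≠ 0 → ∀ d : D, ∃ d' : D, r • d' = d)
    (f : D →ₗ[R] B) (hf : Function.Injective f) : Function.Injective (f.lTensor N) := by
  -- The kernel is the image of `ker q ⊗ D`, which vanishes: `t ⊗ r d' = r t ⊗ d' = 0`.
  have hq' : Function.Injective (q.rTensor D) := by
    rw [← LinearMap.ker_eq_bot, LinearMap.exact_iff.1
      (rTensor_exact D (LinearMap.exact_subtype_ker_map q) hq), LinearMap.range_eq_bot]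
    ext t d
    obtain ⟨r, hr, hrt⟩ := htors t t.2
    obtain ⟨d', rfl⟩ := hD r hr d
    have ht0 : r • t = 0 := Subtype.ext hrt
    change (LinearMap.ker q).subtype t ⊗ₜ[R] (r • d') = 0
    simp only [← TensorProduct.smul_tmul, ← map_smul, ht0, map_zero, TensorProduct.zero_tmul]
  have hcomp : Function.Injective (f.lTensor F ∘ₗ q.rTensor D) :=
    (Module.Flat.lTensor_preserves_injective_linearMap f hf).comp hq'
  rw [LinearMap.lTensor_comp_rTensor, ← LinearMap.rTensor_comp_lTensor] at hcomp
  exact Function.Injective.of_comp hcomp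

/-- Over a domain whose localization at `S` is a valuation ring, a divisible submodule is pure
after localizing at `S`. -/
theorem LocalizedModule.map_rTensor_injective_of_divisible {R : Type*} [CommRing R] [IsDomain R]
    (S : Submonoid R) [IsDomain (Localization S)] [ValuationRing (Localization S)]
    {D B : Type*} [AddCommGroup D] [Module R D] [AddCommGroup B] [Module R B]
    (hD : ∀ r : R, r ≠ 0 → ∀ d : D, ∃ d' : D, r • d' = d)
    (f : D →ₗ[R] B) (hf : Function.Injective f) (M : Type*) [AddCommGroup M] [Module R M] :
    Function.Injective (LocalizedModule.map S (f.rTensor M)) := by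
  let N := LocalizedModule S M
  let T := Submodule.torsion (Localization S) N
  have hflat : Module.Flat (Localization S) (N ⧸ T) :=
    Module.Flat.flat_iff_torsion_eq_bot_of_isBezout.2 Submodule.QuotientTorsion.torsion_eq_bot
  have : Module.Flat R (Localization S) := IsLocalization.flat _ S
  have : Module.Flat R (N ⧸ T) := .trans R (Localization S) _
  have hinj : Function.Injective (f.lTensor N) := by
    refine LinearMap.lTensor_injective_of_divisible (T.mkQ.restrictScalars R) T.mkQ_surjective
      (fun n hn => ?_) hD f hf
    -- The numerator of an annihilator in the localization is a nonzero annihilator in `R`.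
    obtain ⟨⟨v, hv⟩, hvn⟩ : n ∈ T := (Submodule.Quotient.mk_eq_zero T).1 hn
    obtain ⟨r, s, rfl⟩ := IsLocalization.exists_mk'_eq S v
    refine ⟨r, ?_, ?_⟩
    · rintro rfl
      exact nonZeroDivisors.ne_zero hv (IsLocalization.mk'_zero s)
    · rw [← algebraMap_smul (Localization S) r n, ← IsLocalization.mk'_spec' (Localization S) r s,
        mul_smul]
      have hvn' : IsLocalization.mk' (Localization S) r s • n = 0 := hvn
      rw [hvn', smul_zero]
  -- `N ⊗ D` and `N ⊗ B` serve as localizations of `D ⊗ M` and `B ⊗ M`, turning the localized map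
  -- into `f.lTensor N`.
  let gD : D ⊗[R] M →ₗ[R] N ⊗[R] D :=
    (LocalizedModule.mkLinearMap S M).rTensor D ∘ₗ (TensorProduct.comm R D M)
  let gB : B ⊗[R] M →ₗ[R] N ⊗[R] B :=
    (LocalizedModule.mkLinearMap S M).rTensor B ∘ₗ (TensorProduct.comm R B M)
  have hrD : IsLocalizedModule S ((LocalizedModule.mkLinearMap S M).rTensor D) :=
    IsLocalizedModule.rTensor (S := S) (R := R) (g := LocalizedModule.mkLinearMap S M)
  have hrB : IsLocalizedModule S ((LocalizedModule.mkLinearMap S M).rTensor B) :=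
    IsLocalizedModule.rTensor (S := S) (R := R) (g := LocalizedModule.mkLinearMap S M)
  have hgD : IsLocalizedModule S gD := .of_linearEquiv_right _ _ _
  have hgB : IsLocalizedModule S gB := .of_linearEquiv_right _ _ _
  rw [← IsLocalizedModule.map_injective_iff_localizedModuleMap_injective gD gB]
  have hmap : IsLocalizedModule.map S gD gB (f.rTensor M) = f.lTensor N := by
    apply IsLocalizedModule.linearMap_ext S gD gB
    rw [IsLocalizedModule.map_comp]
    ext d m
    simp [gD, gB]
  rwa [hmap]

/-- Over a PvMD, divisible modules are absolutely `w`-pure. -/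
theorem IsPvMD.isAbsolutelyWPure_of_divisible {R : Type u} [CommRing R] [IsDomain R]
    (hR : IsPvMD R) (D : Type u) [AddCommGroup D] [Module R D]
    (hD : ∀ r : R, r ≠ 0 → ∀ d : D, ∃ d' : D, r • d' = d) : IsAbsolutelyWPure R D := by
  intro B _ _ f hf
  have hA : ∀ r : R, r ≠ 0 → ∀ d : LinearMap.range f, ∃ d' : LinearMap.range f, r • d' = d := by
    rintro r hr ⟨_, d, rfl⟩
    obtain ⟨d', rfl⟩ := hD r hr d
    exact ⟨⟨f d', d', rfl⟩, by ext; simp⟩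
  have hexact := LinearMap.exact_subtype_mkQ (LinearMap.range f)
  refine ⟨fun p _ hp => ⟨?_, ?_, ?_⟩, fun M _ _ p _ hp => ⟨?_, ?_, ?_⟩⟩
  · exact LocalizedModule.map_injective _ _ (Submodule.injective_subtype _)
  · exact LocalizedModule.map_exact _ _ _ hexact
  · exact LocalizedModule.map_surjective _ _ (Submodule.mkQ_surjective _)
  · have := hR.valuationRing_localization p hp
    exact LocalizedModule.map_rTensor_injective_of_divisible p.primeCompl hA _
      (Submodule.injective_subtype _) M
  · exact LocalizedModule.map_exact _ _ _ (rTensor_exact M hexact (Submodule.mkQ_surjective _))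
  · exact LocalizedModule.map_surjective _ _
      (LinearMap.rTensor_surjective M (Submodule.mkQ_surjective _))

/-! ### Dimension shifting -/

theorem Module.Injective.exists_smul_eq {R : Type u} [CommRing R] [IsDomain R] (E : Type u)
    [AddCommGroup E] [Module R E] [Module.Injective R E] {r : R} (hr : r ≠ 0) (e : E) :
    ∃ e' : E, r • e' = e := by
  obtain ⟨h, hh⟩ := Module.Injective.out (LinearMap.mulLeft R r) (mul_right_injective₀ hr)
    (LinearMap.toSpanSingleton R E e)
  refine ⟨h 1, ?_⟩
  simpa [← map_smul] using hh 1

theorem mainTheorem8 (R : Type u) [CommRing R] [IsDomain R] (hR : IsPvMD R)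
    (M : Type u) [AddCommGroup M] [Module R M] (hM : IsWFPProjective R M) :
    CategoryTheory.HasProjectiveDimensionLE (ModuleCat.of R M) 1 := by
  open CategoryTheory in
  refine hasProjectiveDimensionLT_of_enoughInjectives _ 2 fun Y => ?_
  obtain ⟨E, hE, i, hi⟩ := EnoughInjectives.presentation Y
  have : Module.Injective R E := (Module.injective_iff_injective_object R E).2 hE
  let L := LinearMap.range i.hom
  have hS : (ModuleCat.shortComplexOfCompEqZero i.hom L.mkQ
      (LinearMap.range_mkQ_comp i.hom)).ShortExact :=
    ModuleCat.shortComplex_shortExact _ (LinearMap.exact_map_mkQ_range i.hom)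
      ((ModuleCat.mono_iff_injective i).1 hi) L.mkQ_surjective
  have hQ : Subsingleton (Abelian.Ext (ModuleCat.of R M) (ModuleCat.of R (E ⧸ L)) 1) := by
    refine hM _ (hR.isAbsolutelyWPure_of_divisible _ fun r hr d => ?_)
    obtain ⟨e, rfl⟩ := L.mkQ_surjective d
    obtain ⟨e', rfl⟩ := Module.Injective.exists_smul_eq E hr e
    exact ⟨L.mkQ e', (map_smul _ _ _).symm⟩
  refine subsingleton_of_forall_eq 0 fun x => ?_
  have : Injective (ModuleCat.of R E) := hE
  -- `x` dies in `Ext²(M, E) = 0`, so it comes from `Ext¹(M, E/L)` by the connecting map.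
  obtain ⟨y, rfl⟩ := Abelian.Ext.covariant_sequence_exact₁ _ hS x
    (Abelian.Ext.eq_zero_of_injective _) (n₀ := 1) rfl
  rw [hQ.elim y 0, Abelian.Ext.zero_comp]
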